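/- Let $G$ be a finite connected (simple, unweighted) graph with vertex set $V$, $n=|V|$, and Laplacian $\mathcal L = D - A$ (degree matrix minus adjacency matrix), and let $q>0$ be real. A rooted spanning forest of $G$ is an acyclic subgraph of $G$ on the whole vertex set $V$ together with a choice of exactly one vertex, the root, in each of its trees (connected components). The uniform random spanning forest with parameter $q$ is the random rooted spanning forest $\Phi$ with $\mathbb P(\Phi=\varphi)\propto q^{\#\text{roots}(\varphi)}$. Let $\mathcal X\subseteq V$ be its set of roots. Definitions. For a matrix $M$ with rows (and, if square, columns) indexed by $V$ and $X \subseteq V$, $M_X$ is the principal submatrix and $M_{X,:}$ the submatrix of the rows in $X$. A random subset $\mathcal X$ of $V$ is a determinantal point process (DPP) with marginal kernel $K\in\mathbb R^{n\times n}$ symmetric, $0\preceq K\preceq I$, if $\mathbb P(A\subseteq\mathcal X)=\det K_A$ for all $A\subseteq V$. A nonnegative pair $(L;W)$ consists of a symmetric $L\in\mathbb R^{n\times n}$ and a matrix $W\in\mathbb R^{n\times p}$ of full column rank such that $x^\top L x\ge 0$ whenever $W^\top x=0$. A partial projection DPP with nonnegative pair $(L;W)$, $p\ge 1$, is a DPP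 such that $$\mathbb P(\mathcal X=X)\;\propto\;(-1)^p\det\begin{pmatrix} L_X & W_{X,:}\\ (W_{X,:})^\top & 0\end{pmatrix}\qquad\text{for all } X\subseteq V.$$ Proposition. $(q\mathcal L^\dagger;\mathbf 1)$ is a nonnegative pair, where $\mathcal L^\dagger$ is the Moore-Penrose inverse of $\mathcal L$ and $\mathbf 1\in\mathbb R^{n\times 1}$ is the all-ones vector, and the set of roots $\mathcal X$ of the uniform random spanning forest of $G$ with parameter $q$ is a partial projection DPP with nonnegative pair $(q\mathcal L^\dagger;\mathbf 1)$. -/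

import Mathlib

namespace RootsForest

open Matrix

/-! ### The Moore-Penrose inverse of a real matrix -/

section MoorePenrose

/-- The four Penrose equations: `B` is the Moore-Penrose inverse of the real matrix `A`. -/
structure IsMoorePenrose {m n : Type*} [Fintype m] [Fintype n]
    (A : Matrix m n ℝ) (B : Matrix n m ℝ) : Prop where
  mul_mul_self : A * B * A = A
  mul_self_mul : B * A * B = B
  symm_left : (A * B)ᵀ = A * B
  symm_right : (B * A)ᵀ = B * A

/-- The Moore-Penrose inverse is unique. -/
theorem IsMoorePenrose.unique {m n : Type*} [Fintype m] [Fintype n]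
    {A : Matrix m n ℝ} {B C : Matrix n m ℝ}
    (hB : IsMoorePenrose A B) (hC : IsMoorePenrose A C) : B = C := by
  have h1 : A * B = A * C := by
    calc A * B = (A * B)ᵀ := hB.symm_left.symm
      _ = ((A * C) * (A * B))ᵀ := by rw [← Matrix.mul_assoc, hC.mul_mul_self]
      _ = (A * B)ᵀ * (A * C)ᵀ := Matrix.transpose_mul _ _
      _ = A * B * (A * C) := by rw [hB.symm_left, hC.symm_left]
      _ = A * C := by rw [← Matrix.mul_assoc, hB.mul_mul_self]
  have h2 : B * A = C * A := by
    calc B * A = (B * A)ᵀ := hB.symm_right.symm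
      _ = ((B * A) * (C * A))ᵀ := by
        rw [Matrix.mul_assoc, ← Matrix.mul_assoc A C A, hC.mul_mul_self]
      _ = (C * A)ᵀ * (B * A)ᵀ := Matrix.transpose_mul _ _
      _ = C * A * (B * A) := by rw [hB.symm_right, hC.symm_right]
      _ = C * A := by rw [Matrix.mul_assoc, ← Matrix.mul_assoc A B A, hB.mul_mul_self]
  calc B = B * A * B := hB.mul_self_mul.symm
    _ = C * A * C := by rw [h2, Matrix.mul_assoc, h1, ← Matrix.mul_assoc]
    _ = C := hC.mul_self_mul

theorem exists_symm_isMoorePenrose {n : Type*} [Fintype n]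
    (H : Matrix n n ℝ) (hH : H.IsHermitian) :
    ∃ B : Matrix n n ℝ, IsMoorePenrose H B ∧ Bᵀ = B := by
  classical
  obtain ⟨U, d, hUU, rfl⟩ : ∃ (U : Matrix n n ℝ) (d : n → ℝ),
      Uᵀ * U = 1 ∧ H = U * diagonal d * Uᵀ := by
    refine ⟨(hH.eigenvectorUnitary : Matrix n n ℝ), hH.eigenvalues, ?_, ?_⟩
    · have := Unitary.coe_star_mul_self hH.eigenvectorUnitary
      simpa [star_eq_conjTranspose, Matrix.conjTranspose_eq_transpose_of_trivial] using this
    · have := hH.spectral_theorem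
      rw [Unitary.conjStarAlgAut_apply] at this
      simpa [star_eq_conjTranspose, Matrix.conjTranspose_eq_transpose_of_trivial,
        Function.comp_def] using this
  have key : ∀ a b : n → ℝ, (U * diagonal a * Uᵀ) * (U * diagonal b * Uᵀ) =
      U * diagonal (fun i => a i * b i) * Uᵀ := by
    intro a b
    calc (U * diagonal a * Uᵀ) * (U * diagonal b * Uᵀ)
        = U * diagonal a * (Uᵀ * U) * diagonal b * Uᵀ := by simp only [Matrix.mul_assoc]
      _ = _ := by rw [hUU, Matrix.mul_one, Matrix.mul_assoc U, diagonal_mul_diagonal]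
  have ksymm : ∀ a : n → ℝ, (U * diagonal a * Uᵀ)ᵀ = U * diagonal a * Uᵀ := by
    intro a
    simp [Matrix.transpose_mul, Matrix.mul_assoc]
  refine ⟨U * diagonal (fun i => (d i)⁻¹) * Uᵀ, ⟨?_, ?_, ?_, ?_⟩, ksymm _⟩
  · rw [key, key]
    simp
  · rw [key, key]
    have : ∀ x : ℝ, x⁻¹ * x * x⁻¹ = x⁻¹ := fun x => by
      by_cases hx : x = 0 <;> simp [hx]
    simp [this]
  · rw [key, ksymm]
  · rw [key, ksymm]

/-- Every real matrix has a Moore-Penrose inverse. -/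
theorem exists_isMoorePenrose {m n : Type*} [Fintype m] [Fintype n] (A : Matrix m n ℝ) :
    ∃ B : Matrix n m ℝ, IsMoorePenrose A B := by
  classical
  have hH : (Aᵀ * A).IsHermitian := by
    simpa [Matrix.conjTranspose_eq_transpose_of_trivial] using
      Matrix.isHermitian_conjTranspose_mul_self A
  obtain ⟨B, hB, hBs⟩ := exists_symm_isMoorePenrose (Aᵀ * A) hH
  have e1 : A * B * (Aᵀ * A) = A := by
    have hz : (A * (B * (Aᵀ * A)) - A)ᵀ * (A * (B * (Aᵀ * A)) - A) = 0 := by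
      have ht : (A * (B * (Aᵀ * A)) - A)ᵀ = (B * (Aᵀ * A)) * Aᵀ - Aᵀ := by
        rw [Matrix.transpose_sub, Matrix.transpose_mul, hB.symm_right]
      have h0 : Aᵀ * (A * (B * (Aᵀ * A)) - A) = 0 := by
        rw [Matrix.mul_sub, ← Matrix.mul_assoc, ← Matrix.mul_assoc, hB.mul_mul_self, sub_self]
      rw [ht, Matrix.sub_mul, Matrix.mul_assoc (B * (Aᵀ * A)), h0]
      simp
    have := Matrix.conjTranspose_mul_self_eq_zero.mp
      ((congrArg (· * _) (Matrix.conjTranspose_eq_transpose_of_trivial _)).trans hz)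
    rw [Matrix.mul_assoc]
    exact sub_eq_zero.mp this
  refine ⟨B * Aᵀ, ?_, ?_, ?_, ?_⟩
  · simpa only [Matrix.mul_assoc] using e1
  · have := congrArg (· * Aᵀ) hB.mul_self_mul
    simpa only [Matrix.mul_assoc] using this
  · simp [Matrix.transpose_mul, hBs, Matrix.mul_assoc]
  · have := hB.symm_right
    simpa only [Matrix.mul_assoc] using this

/-- The Moore-Penrose inverse `A†` of a real matrix. -/
noncomputable def pinv {m n : Type*} [Fintype m] [Fintype n] (A : Matrix m n ℝ) : Matrix n m ℝ :=
  (exists_isMoorePenrose A).choose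

theorem isMoorePenrose_pinv {m n : Type*} [Fintype m] [Fintype n] (A : Matrix m n ℝ) :
    IsMoorePenrose A (pinv A) :=
  (exists_isMoorePenrose A).choose_spec

end MoorePenrose

/-! ### Point processes on a finite ground set

A point process on `Ω` is given by its law, a probability mass function on the subsets of `Ω`. -/

section PointProcesses

/-- A point process with law `μ` is a determinantal point process with marginal kernel `K`. -/
structure IsDPP {Ω : Type*} [Fintype Ω] [DecidableEq Ω]
    (μ : PMF (Finset Ω)) (K : Matrix Ω Ω ℝ) : Prop where
  kernel_nonneg : K.PosSemidef
  kernel_le_one : (1 - K).PosSemidef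
  /-- The probability that `A` is contained in the process is `det K_A`. -/
  inclusion : ∀ A : Finset Ω,
    ∑ X : Finset Ω with A ⊆ X, (μ X).toReal =
      (K.submatrix (Subtype.val : A → Ω) (Subtype.val : A → Ω)).det

/-- Nonnegative pairs `(L; V)`: `L` is symmetric and conditionally positive semi-definite with
respect to `V`, and `V` has full column rank. -/
structure IsNonnegativePair {Ω κ : Type*} [Fintype Ω] [Fintype κ]
    (L : Matrix Ω Ω ℝ) (V : Matrix Ω κ ℝ) : Prop where
  symm : Lᵀ = L
  cond_nonneg : ∀ x : Ω → ℝ, Vᵀ *ᵥ x = 0 → 0 ≤ x ⬝ᵥ (L *ᵥ x)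
  full_rank : V.rank = Fintype.card κ

/-- The unnormalised mass `(-1)^p det [[L_X, V_{X,:}], [(V_{X,:})ᵀ, 0]]` of the set `X`. -/
noncomputable def extMass {Ω κ : Type*} [DecidableEq Ω] [Fintype κ] [DecidableEq κ]
    (L : Matrix Ω Ω ℝ) (V : Matrix Ω κ ℝ) (X : Finset Ω) : ℝ :=
  (-1) ^ Fintype.card κ *
    (Matrix.fromBlocks
      (L.submatrix (Subtype.val : X → Ω) (Subtype.val : X → Ω))
      (V.submatrix (Subtype.val : X → Ω) id)
      (V.submatrix (Subtype.val : X → Ω) id)ᵀ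
      (0 : Matrix κ κ ℝ)).det

/-- Extended L-ensembles based on the nonnegative pair `(L; V)`: the probability mass function is
proportional to `extMass L V`. -/
structure IsExtendedLEnsemble {Ω κ : Type*} [Fintype Ω] [DecidableEq Ω] [Fintype κ]
    [DecidableEq κ] (μ : PMF (Finset Ω)) (L : Matrix Ω Ω ℝ) (V : Matrix Ω κ ℝ) : Prop where
  pair : IsNonnegativePair L V
  proportional : ∃ c : ℝ, 0 < c ∧ ∀ X : Finset Ω, (μ X).toReal = c * extMass L V X

/-- Partial-projection DPPs with nonnegative pair `(L; V)`: the determinantal point processes that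
are extended L-ensembles based on a nonnegative pair `(L; V)` whose `V` has `p ≥ 1` columns. -/
structure IsPartialProjectionDPP {Ω κ : Type*} [Fintype Ω] [DecidableEq Ω] [Fintype κ]
    [DecidableEq κ] (μ : PMF (Finset Ω)) (L : Matrix Ω Ω ℝ) (V : Matrix Ω κ ℝ) : Prop where
  isDPP : ∃ K : Matrix Ω Ω ℝ, IsDPP μ K
  one_le_card : 1 ≤ Fintype.card κ
  isExtendedLEnsemble : IsExtendedLEnsemble μ L V

/-- The all-ones vector, as a matrix with a single column. -/
def onesCol (Ω : Type*) : Matrix Ω (Fin 1) ℝ := Matrix.of fun _ _ => 1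

end PointProcesses

/-! ### Uniform random spanning forests -/

section Forests

/-- A rooted spanning forest of `G`: an acyclic subgraph on all the vertices of `G`, together with
a set of roots that contains exactly one vertex of each tree (each connected component). -/
@[ext]
structure RootedSpanningForest {V : Type*} (G : SimpleGraph V) where
  forest : SimpleGraph V
  roots : Finset V
  forest_le : forest ≤ G
  acyclic : forest.IsAcyclic
  existsUnique_root : ∀ v : V, ∃! r : V, r ∈ roots ∧ forest.Reachable v r

instance {V : Type*} [Finite V] (G : SimpleGraph V) : Finite (RootedSpanningForest G) :=
  Finite.of_injective (fun φ : RootedSpanningForest G => (φ.forest, φ.roots)) fun φ ψ h => by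
    rw [Prod.mk.injEq] at h
    exact RootedSpanningForest.ext h.1 h.2

/-- The forest without edges, in which every vertex is a root. -/
instance {V : Type*} [Fintype V] (G : SimpleGraph V) : Nonempty (RootedSpanningForest G) :=
  ⟨{ forest := ⊥
     roots := Finset.univ
     forest_le := bot_le
     acyclic := SimpleGraph.isAcyclic_bot
     existsUnique_root := fun v => ⟨v, by simp, fun r hr => by
       simpa using (SimpleGraph.reachable_bot.mp hr.2).symm⟩ }⟩

/-- The law of the uniform random spanning forest of `G` with parameter `q > 0`: a rooted spanning
forest has probability proportional to `q ^ (number of roots)`. -/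
noncomputable def spanningForestLaw {V : Type*} [Fintype V] (G : SimpleGraph V)
    (q : ℝ) (hq : 0 < q) : PMF (RootedSpanningForest G) :=
  PMF.normalize (fun φ => ENNReal.ofReal (q ^ φ.roots.card))
    (by
      obtain ⟨φ⟩ := (inferInstance : Nonempty (RootedSpanningForest G))
      intro h
      have h0 := ENNReal.tsum_eq_zero.mp h φ
      rw [ENNReal.ofReal_eq_zero] at h0
      exact absurd (pow_pos hq φ.roots.card) (not_lt.mpr h0))
    (by
      have := Fintype.ofFinite (RootedSpanningForest G)
      rw [tsum_fintype]
      exact ENNReal.sum_ne_top.mpr fun _ _ => ENNReal.ofReal_ne_top)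

/-- The law of the set of roots of the uniform random spanning forest of `G` with parameter `q`. -/
noncomputable def rootsLaw {V : Type*} [Fintype V] (G : SimpleGraph V)
    (q : ℝ) (hq : 0 < q) : PMF (Finset V) :=
  (spanningForestLaw G q hq).map RootedSpanningForest.roots

end Forests

end RootsForest

/-! Put T = q⁻¹𝓛 and n = |V|. A rooted forest amounts to a map sending each non-root one step
towards its root. Expanding the minor of 𝓛 with X deleted along its rows gives one term for each
choice of neighbours; the term is 1 if every orbit ends in X and 0 otherwise. So this minor counts
the forests with root set X (`complMinor_lapMatrix`), and after normalisation P(X) = `complMinor T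
X` / det(1 + T) (`rootsLaw_toReal`).

Both claims then follow from Jacobi's identity (`det_submatrix_inl`). Summing the minors over X ⊇ A
gives `complMinor (1 + T) A` (`sum_complMinor`), hence a DPP with kernel (1 + T)⁻¹. On a connected
graph 𝓛†𝓛 = 1 - 𝟙𝟙ᵀ/n, so [[q𝓛†, 𝟙], [𝟙ᵀ, 0]] has inverse [[T, 𝟙/n], [𝟙ᵀ/n, 0]], and the extended
mass of X is proportional to `complMinor T X` (`exists_extMass_eq`). -/

namespace RootsForest

open Matrix

/-! ### Rooted forests as maps towards the roots -/

section RootMaps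

variable {V : Type*}

/-- Maps that fix the vertices of `X`, move every other vertex to a neighbour in `G`, and whose
iterates lead every vertex to `X`. -/
structure IsRootMap (G : SimpleGraph V) (X : Finset V) (f : V → V) : Prop where
  fixed : ∀ v ∈ X, f v = v
  adj : ∀ v ∉ X, G.Adj v (f v)
  exists_iterate_mem : ∀ v, ∃ k : ℕ, f^[k] v ∈ X

namespace IsRootMap

variable {G : SimpleGraph V} {X : Finset V} {f g : V → V}

theorem iterate_fixed (h : IsRootMap G X f) {r : V} (hr : r ∈ X) (k : ℕ) : f^[k] r = r :=
  Function.iterate_fixed (h.fixed r hr) k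

theorem iterate_apply_ne (h : IsRootMap G X f) {v : V} (hv : v ∉ X) (k : ℕ) :
    f^[k] (f v) ≠ v := by
  intro hk
  obtain ⟨m, hm⟩ := h.exists_iterate_mem v
  have hp : f^[k + 1] v = v := by rwa [Function.iterate_succ_apply]
  -- A multiple of the period `k + 1` that is at least `m`: by then the orbit is stuck in `X`.
  have h1 : f^[m * (k + 1)] v = v := by
    rw [mul_comm, Function.iterate_mul]
    exact Function.iterate_fixed hp m
  have h2 : m * (k + 1) = m * k + m := by ring
  rw [h2, Function.iterate_add_apply, h.iterate_fixed hm] at h1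
  exact hv (h1 ▸ hm)

end IsRootMap

/-- The graph whose edges join each vertex to its image under `f`. -/
def mapGraph (f : V → V) : SimpleGraph V := SimpleGraph.fromRel fun u v => f u = v

theorem mapGraph_adj {f : V → V} {u v : V} :
    (mapGraph f).Adj u v ↔ u ≠ v ∧ (f u = v ∨ f v = u) :=
  SimpleGraph.fromRel_adj _ _ _

theorem mapGraph_reachable_apply (f : V → V) (v : V) : (mapGraph f).Reachable v (f v) := by
  by_cases h : v = f v
  · rw [← h]
  · exact (mapGraph_adj.mpr ⟨h, Or.inl rfl⟩).reachable

theorem mapGraph_reachable_iterate (f : V → V) (v : V) (k : ℕ) :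
    (mapGraph f).Reachable v (f^[k] v) := by
  induction k with
  | zero => rfl
  | succ k ih =>
    rw [Function.iterate_succ_apply']
    exact ih.trans (mapGraph_reachable_apply f _)

theorem _root_.SimpleGraph.Reachable.of_forall_adj {H : SimpleGraph V} {P : V → Prop}
    (hP : ∀ x y, H.Adj x y → P x → P y) {u v : V} (h : H.Reachable u v) (hu : P u) : P v := by
  obtain ⟨p⟩ := h
  induction p with
  | nil => exact hu
  | cons hadj _ ih => exact ih (hP _ _ hadj hu)

namespace IsRootMap

variable {G : SimpleGraph V} {X : Finset V} {f g : V → V}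

/-- Every edge v–f v is a bridge: once it is deleted, the vertices whose orbit passes through v are
closed under adjacency. If f v were among them, v would be periodic outside X. -/
theorem isAcyclic (h : IsRootMap G X f) : (mapGraph f).IsAcyclic := by
  rw [SimpleGraph.isAcyclic_iff_forall_adj_isBridge]
  have key : ∀ v w, v ≠ w → f v = w → (mapGraph f).IsBridge s(v, w) := by
    rintro v w hne rfl
    have hv : v ∉ X := fun hv => hne (h.fixed v hv).symm
    rw [SimpleGraph.isBridge_iff]
    intro hr
    obtain ⟨k, hk⟩ : ∃ k : ℕ, f^[k] (f v) = v := by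
      refine hr.of_forall_adj (P := fun x => ∃ k : ℕ, f^[k] x = v) ?_ ⟨0, rfl⟩
      rintro x y hxy ⟨k, hk⟩
      rw [SimpleGraph.deleteEdges_adj, mapGraph_adj] at hxy
      obtain ⟨⟨-, rfl | rfl⟩, hdel⟩ := hxy
      · cases k with
        | zero =>
          obtain rfl : x = v := hk
          exact absurd rfl hdel
        | succ k => exact ⟨k, hk⟩
      · exact ⟨k + 1, hk⟩
    exact h.iterate_apply_ne hv k hk
  intro v w hvw
  obtain ⟨hne, hf | hf⟩ := mapGraph_adj.mp hvw
  · exact key v w hne hf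
  · rw [Sym2.eq_swap]
    exact key w v hne.symm hf

theorem mapGraph_le (h : IsRootMap G X f) : mapGraph f ≤ G := by
  have key : ∀ v, v ≠ f v → G.Adj v (f v) := fun v hne =>
    h.adj v fun hv => hne (h.fixed v hv).symm
  intro u v huv
  obtain ⟨hne, rfl | rfl⟩ := mapGraph_adj.mp huv
  · exact key u hne
  · exact (key v hne.symm).symm

theorem eq_of_reachable (h : IsRootMap G X f) {r s : V} (hr : r ∈ X) (hs : s ∈ X)
    (hrs : (mapGraph f).Reachable r s) : r = s := by
  obtain ⟨k, hk⟩ : ∃ k : ℕ, f^[k] s = r := by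
    refine hrs.of_forall_adj (P := fun x => ∃ k : ℕ, f^[k] x = r) ?_ ⟨0, rfl⟩
    rintro x y hxy ⟨k, hk⟩
    obtain ⟨-, rfl | rfl⟩ := mapGraph_adj.mp hxy
    · refine ⟨k, ?_⟩
      rw [← Function.iterate_succ_apply, Function.iterate_succ_apply', hk, h.fixed r hr]
    · exact ⟨k + 1, hk⟩
  rw [← hk, h.iterate_fixed hs]

/-- The rooted spanning forest of a root map. -/
def toForest (h : IsRootMap G X f) : RootedSpanningForest G where
  forest := mapGraph f
  roots := X
  forest_le := h.mapGraph_le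
  acyclic := h.isAcyclic
  existsUnique_root v := by
    obtain ⟨k, hk⟩ := h.exists_iterate_mem v
    exact ⟨f^[k] v, ⟨hk, mapGraph_reachable_iterate f v k⟩, fun s hs =>
      h.eq_of_reachable hs.1 hk (hs.2.symm.trans (mapGraph_reachable_iterate f v k))⟩

/-- Induction on the number of steps to X. The edge v–f v comes from g, so either g v = f v or g (f
v) = v; in the second case the induction hypothesis at f v makes v a point of period two for f. -/
theorem eq_of_mapGraph_eq (hf : IsRootMap G X f) (hg : IsRootMap G X g)
    (hfg : mapGraph f = mapGraph g) : f = g := by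
  have key : ∀ (k : ℕ) (v : V), f^[k] v ∈ X → f v = g v := by
    intro k
    induction k with
    | zero => exact fun v hv => (hf.fixed v hv).trans (hg.fixed v hv).symm
    | succ k ih =>
      intro v hv
      by_cases hvX : v ∈ X
      · exact (hf.fixed v hvX).trans (hg.fixed v hvX).symm
      have hadj : (mapGraph g).Adj v (f v) := by
        rw [← hfg, mapGraph_adj]
        exact ⟨(hf.adj v hvX).ne, Or.inl rfl⟩
      obtain ⟨-, h1 | h1⟩ := mapGraph_adj.mp hadj
      · exact h1.symm
      · rw [← ih (f v) hv] at h1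
        exact absurd h1 (hf.iterate_apply_ne hvX 1)
  funext v
  obtain ⟨k, hk⟩ := hf.exists_iterate_mem v
  exact key k v hk

end IsRootMap

/-- Each non-root moves one step along a geodesic to its root. A forest edge missed by this map
would not be a bridge, since the map already joins its ends through their common root. -/
theorem RootedSpanningForest.exists_isRootMap {G : SimpleGraph V} (φ : RootedSpanningForest G) :
    ∃ f, IsRootMap G φ.roots f ∧ mapGraph f = φ.forest := by
  classical
  choose ρ hρ huniq using φ.existsUnique_root
  have hstep : ∀ v, ∃ w, (v ∈ φ.roots → w = v) ∧
      (v ∉ φ.roots → φ.forest.Adj v w ∧ φ.forest.dist w (ρ v) < φ.forest.dist v (ρ v)) := by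
    intro v
    by_cases hv : v ∈ φ.roots
    · exact ⟨v, fun _ => rfl, fun h => absurd hv h⟩
    obtain ⟨p, hp⟩ := (hρ v).2.exists_walk_length_eq_dist
    generalize hr : ρ v = r at p hp
    cases p with
    | nil => exact absurd (hr ▸ (hρ v).1) hv
    | @cons _ w _ hadj p =>
      refine ⟨w, fun h => absurd h hv, fun _ => ⟨hadj, ?_⟩⟩
      rw [← hp, SimpleGraph.Walk.length_cons]
      exact Nat.lt_succ_of_le (SimpleGraph.dist_le p)
  choose f hfix hf using hstep
  have hmap : IsRootMap G φ.roots f := by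
    refine ⟨hfix, fun v hv => φ.forest_le (hf v hv).1, ?_⟩
    suffices h : ∀ (d : ℕ) (v : V), φ.forest.dist v (ρ v) ≤ d → ∃ k : ℕ, f^[k] v ∈ φ.roots from
      fun v => h _ v le_rfl
    intro d
    induction d with
    | zero =>
      intro v hd
      have h0 := (hρ v).2.dist_eq_zero_iff.mp (Nat.le_zero.mp hd)
      exact ⟨0, h0 ▸ (hρ v).1⟩
    | succ d ih =>
      intro v hd
      by_cases hv : v ∈ φ.roots
      · exact ⟨0, hv⟩
      obtain ⟨hadj, hlt⟩ := hf v hv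
      have hroot : ρ v = ρ (f v) :=
        huniq (f v) (ρ v) ⟨(hρ v).1, hadj.symm.reachable.trans (hρ v).2⟩
      obtain ⟨k, hk⟩ := ih (f v) (by rw [← hroot]; omega)
      exact ⟨k + 1, hk⟩
  refine ⟨f, hmap, ?_⟩
  have hle : mapGraph f ≤ φ.forest := by
    have key : ∀ v, v ≠ f v → φ.forest.Adj v (f v) := fun v hne =>
      (hf v fun hv => hne (hfix v hv).symm).1
    intro u v huv
    obtain ⟨hne, rfl | rfl⟩ := mapGraph_adj.mp huv
    · exact key u hne
    · exact (key v hne.symm).symm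
  refine le_antisymm hle fun u v huv => ?_
  by_contra hnot
  refine SimpleGraph.isAcyclic_iff_forall_adj_isBridge.mp φ.acyclic huv ?_
  have hsub : mapGraph f ≤ φ.forest.deleteEdges {s(u, v)} := by
    intro x y hxy
    rw [SimpleGraph.deleteEdges_adj]
    refine ⟨hle hxy, fun h => hnot ?_⟩
    rwa [← SimpleGraph.mem_edgeSet, ← Set.mem_singleton_iff.mp h, SimpleGraph.mem_edgeSet]
  obtain ⟨k, hk⟩ := hmap.exists_iterate_mem u
  obtain ⟨l, hl⟩ := hmap.exists_iterate_mem v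
  have hu := mapGraph_reachable_iterate f u k
  have hv := mapGraph_reachable_iterate f v l
  have heq : f^[k] u = f^[l] v :=
    (huniq u _ ⟨hk, hu.mono hle⟩).trans
      (huniq u _ ⟨hl, huv.reachable.trans (hv.mono hle)⟩).symm
  exact ((hu.trans (heq ▸ hv.symm))).mono hsub

/-- Root maps with root set `X` correspond to the rooted spanning forests with root set `X`. -/
theorem card_rootMaps (G : SimpleGraph V) (X : Finset V) :
    Nat.card {f : V → V // IsRootMap G X f} =
      Nat.card {φ : RootedSpanningForest G // φ.roots = X} := by
  refine Nat.card_eq_of_bijective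
    (fun f => ⟨f.2.toForest, rfl⟩) ⟨fun f g hfg => ?_, ?_⟩
  · refine Subtype.ext (f.2.eq_of_mapGraph_eq g.2 ?_)
    exact congrArg (fun φ => φ.1.forest) hfg
  · rintro ⟨φ, rfl⟩
    obtain ⟨f, hf, hfφ⟩ := φ.exists_isRootMap
    exact ⟨⟨f, hf⟩, Subtype.ext (RootedSpanningForest.ext hfφ rfl)⟩

end RootMaps

/-! ### Complementary minors and Jacobi's identity -/

section Minors

variable {V : Type*} [Fintype V] [DecidableEq V]

/-- The principal minor of `B` with the rows and columns in `X` deleted. -/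
noncomputable def complMinor (B : Matrix V V ℝ) (X : Finset V) : ℝ :=
  (B.submatrix (Subtype.val : {x // x ∉ X} → V) Subtype.val).det

/-- Writes the minor as a determinant over all of V, where multilinearity in the rows applies. -/
theorem det_ite_one (B : Matrix V V ℝ) (X : Finset V) :
    (Matrix.of fun i j => if i ∈ X then (1 : Matrix V V ℝ) i j else B i j).det =
      complMinor B X := by
  rw [twoBlockTriangular_det' _ (· ∈ X)]
  · refine (congrArg₂ (· * ·) (?_ : _ = (1 : ℝ)) ?_).trans (one_mul _)
    · rw [← det_one (n := {x // x ∈ X})]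
      convert rfl using 2
      ext i j
      simp [toSquareBlockProp_def, Matrix.one_apply]
    · rw [complMinor]
      convert rfl using 2
      ext i j
      simp [toSquareBlockProp_def, i.2]
  · intro i hi j hj
    have : i ≠ j := fun h => hj (h ▸ hi)
    simp [hi, this]

theorem complMinor_smul (c : ℝ) (B : Matrix V V ℝ) (X : Finset V) :
    complMinor (c • B) X = c ^ (Fintype.card V - X.card) * complMinor B X := by
  rw [complMinor, complMinor, ← Fintype.card_coe X, ← Fintype.card_subtype_compl, ← det_smul]
  rfl

/-- Multilinear expansion of det(1 + C), where C is B with the rows in A set to zero: a term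
choosing a row of C inside A vanishes, so only the sets X ⊇ A survive. -/
theorem sum_complMinor (B : Matrix V V ℝ) (A : Finset V) :
    ∑ X : Finset V with A ⊆ X, complMinor B X = complMinor (1 + B) A := by
  let C : Matrix V V ℝ := Matrix.of fun i j => if i ∈ A then 0 else B i j
  have hC : (Matrix.of fun i j => if i ∈ A then (1 : Matrix V V ℝ) i j else (1 + B) i j) =
      1 + C := by
    ext i j
    by_cases hi : i ∈ A <;> simp [C, hi]
  rw [← det_ite_one, hC]
  have hexp : (1 + C).det = ∑ X : Finset V,
      (Matrix.of fun i j => if i ∈ X then (1 : Matrix V V ℝ) i j else C i j).det := by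
    refine ((detRowAlternating (n := V) (R := ℝ)).map_add_univ (1 : Matrix V V ℝ) C).trans ?_
    refine Finset.sum_congr rfl fun X _ => ?_
    refine congrArg Matrix.det ?_
    ext i j
    by_cases hi : i ∈ X <;> simp [Finset.piecewise, hi]
  rw [hexp, Finset.sum_filter]
  refine Finset.sum_congr rfl fun X _ => ?_
  split_ifs with hAX
  · rw [← det_ite_one]
    congr 1
    ext i j
    by_cases hi : i ∈ X
    · simp [hi]
    · have : i ∉ A := fun h => hi (hAX h)
      simp [hi, C, this]
  · obtain ⟨a, haA, haX⟩ := Finset.not_subset.mp hAX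
    exact (det_eq_zero_of_row_eq_zero a fun j => by simp [haX, C, haA]).symm

/-- Jacobi's identity for complementary minors of inverse matrices. -/
theorem det_submatrix_inl {m k n : Type*} [Fintype m] [DecidableEq m] [Fintype k] [DecidableEq k]
    [Fintype n] [DecidableEq n] (e : m ⊕ k ≃ n) {A B : Matrix n n ℝ} (hAB : A * B = 1) :
    (A.submatrix (e ∘ Sum.inl) (e ∘ Sum.inl)).det =
      A.det * (B.submatrix (e ∘ Sum.inr) (e ∘ Sum.inr)).det := by
  have hA : A.submatrix e e = fromBlocks (A.submatrix (e ∘ Sum.inl) (e ∘ Sum.inl))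
      (A.submatrix (e ∘ Sum.inl) (e ∘ Sum.inr)) (A.submatrix (e ∘ Sum.inr) (e ∘ Sum.inl))
      (A.submatrix (e ∘ Sum.inr) (e ∘ Sum.inr)) := by
    ext (i | i) (j | j) <;> rfl
  have hB : B.submatrix e e = fromBlocks (B.submatrix (e ∘ Sum.inl) (e ∘ Sum.inl))
      (B.submatrix (e ∘ Sum.inl) (e ∘ Sum.inr)) (B.submatrix (e ∘ Sum.inr) (e ∘ Sum.inl))
      (B.submatrix (e ∘ Sum.inr) (e ∘ Sum.inr)) := by
    ext (i | i) (j | j) <;> rfl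
  have hone : A.submatrix e e * B.submatrix e e = 1 := by
    rw [submatrix_mul_equiv, hAB, submatrix_one_equiv]
  rw [hA, hB, fromBlocks_multiply, ← fromBlocks_one, fromBlocks_inj] at hone
  -- Take determinants in A · [[1, B₁₂], [0, B₂₂]] = [[A₁₁, 0], [A₂₁, 1]].
  have hdet := det_fromBlocks_zero₂₁ (1 : Matrix m m ℝ)
    (B.submatrix (e ∘ Sum.inl) (e ∘ Sum.inr)) (B.submatrix (e ∘ Sum.inr) (e ∘ Sum.inr))
  rw [det_one, one_mul] at hdet
  rw [← hdet, ← det_submatrix_equiv_self e A, hA, ← det_mul, fromBlocks_multiply,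
    hone.2.1, hone.2.2.2]
  simp

/-- Principal minors of an inverse matrix. -/
theorem det_submatrix_eq_det_mul_complMinor {A B : Matrix V V ℝ} (hAB : A * B = 1)
    (X : Finset V) :
    (A.submatrix (Subtype.val : X → V) (Subtype.val : X → V)).det = A.det * complMinor B X :=
  det_submatrix_inl (Equiv.sumCompl (· ∈ X)) hAB

end Minors

/-! ### The matrix-tree theorem for forests -/

section MatrixTree

variable {V : Type*} [Fintype V] [DecidableEq V]

/-- The transition matrix of `f`, stopped on `X`. -/
def stoppedMatrix (X : Finset V) (f : V → V) : Matrix V V ℝ :=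
  Matrix.of fun i => if i ∈ X then 0 else Pi.single (f i) 1

theorem stoppedMatrix_mulVec (X : Finset V) (f : V → V) (x : V → ℝ) (i : V) :
    (stoppedMatrix X f *ᵥ x) i = if i ∈ X then 0 else x (f i) := by
  by_cases hi : i ∈ X <;> simp [stoppedMatrix, mulVec, hi]

/-- Each factor moves one step along the orbit. The inequality is strict because the row of a point
of X vanishes only when one further factor is applied there. -/
theorem stoppedMatrix_pow_mulVec {X : Finset V} {f : V → V} {m : ℕ} (k : ℕ) (hmk : m < k) (i : V)
    (hm : f^[m] i ∈ X) (x : V → ℝ) : ((stoppedMatrix X f) ^ k *ᵥ x) i = 0 := by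
  induction k generalizing m i with
  | zero => omega
  | succ k ih =>
    rw [pow_succ', ← mulVec_mulVec, stoppedMatrix_mulVec]
    split_ifs with hi
    · rfl
    · cases m with
      | zero => exact absurd hm hi
      | succ m => exact ih (by omega) (f i) hm

/-- The stopped matrix is nilpotent, so its characteristic polynomial is a power of the variable,
with value 1 at 1. -/
theorem det_one_sub_stoppedMatrix_of_forall {X : Finset V} {f : V → V}
    (h : ∀ v, ∃ k : ℕ, f^[k] v ∈ X) : (1 - stoppedMatrix X f).det = 1 := by
  choose k hk using h
  have hnil : IsNilpotent (stoppedMatrix X f) := by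
    -- An exponent exceeding every hitting time at once.
    refine ⟨∑ v, k v + 1, ?_⟩
    apply Matrix.ext_of_mulVec_single
    intro j
    ext i
    rw [stoppedMatrix_pow_mulVec (m := k i) _ _ i (hk i)]
    · simp
    · exact Nat.lt_succ_of_le (Finset.single_le_sum (f := k) (fun _ _ => Nat.zero_le _)
        (Finset.mem_univ i))
  have hchar := sub_eq_zero.mp
    (Matrix.isNilpotent_charpoly_sub_pow_of_isNilpotent hnil).eq_zero
  have heval := Matrix.eval_charpoly (stoppedMatrix X f) 1
  rw [hchar] at heval
  simpa using heval.symm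

/-- The indicator of the vertices that never reach X is a nonzero kernel vector: it vanishes on X
and is constant along orbits. -/
theorem det_one_sub_stoppedMatrix_of_not {X : Finset V} {f : V → V}
    (h : ¬ ∀ v, ∃ k : ℕ, f^[k] v ∈ X) :
    (1 - stoppedMatrix X f).det = 0 := by
  classical
  rw [← Matrix.exists_mulVec_eq_zero_iff]
  refine ⟨fun v => if ∃ k : ℕ, f^[k] v ∈ X then 0 else 1, fun h0 => h fun v => ?_, ?_⟩
  · by_contra hv
    simpa [hv] using congrFun h0 v
  · ext v
    rw [sub_mulVec, one_mulVec, Pi.sub_apply, stoppedMatrix_mulVec, Pi.zero_apply]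
    by_cases hv : v ∈ X
    · have : ∃ k : ℕ, f^[k] v ∈ X := ⟨0, hv⟩
      simp [hv, this]
    · have : (∃ k : ℕ, f^[k] v ∈ X) ↔ ∃ k : ℕ, f^[k] (f v) ∈ X := by
        refine ⟨?_, fun ⟨k, hk⟩ => ⟨k + 1, hk⟩⟩
        rintro ⟨_ | k, hk⟩
        · exact absurd hk hv
        · exact ⟨k, hk⟩
      simp [hv, this]

/-- The matrix-tree theorem for rooted spanning forests with a prescribed set of roots. -/
theorem complMinor_lapMatrix (G : SimpleGraph V) [DecidableRel G.Adj] (X : Finset V) :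
    complMinor (G.lapMatrix ℝ) X = Nat.card {φ : RootedSpanningForest G // φ.roots = X} := by
  classical
  -- A non-root row of 𝓛 is the sum of eᵢ - eⱼ over the neighbours j of i. A root has a single
  -- choice, giving the row eᵢ.
  let S : V → Finset V := fun i => if i ∈ X then {i} else G.neighborFinset i
  let g : V → V → V → ℝ := fun i j =>
    (1 : Matrix V V ℝ) i - if i ∈ X then 0 else Pi.single j 1
  have hrow : (Matrix.of fun i j => if i ∈ X then (1 : Matrix V V ℝ) i j else G.lapMatrix ℝ i j) =
      fun i => ∑ j ∈ S i, g i j := by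
    ext i j
    by_cases hi : i ∈ X
    · simp [S, g, hi]
    · simp [S, g, hi, SimpleGraph.lapMatrix, SimpleGraph.degMatrix, Matrix.one_apply,
        Matrix.diagonal_apply, Pi.single_apply, SimpleGraph.adjMatrix_apply, Finset.sum_apply]
  rw [← det_ite_one, hrow, ← card_rootMaps]
  refine ((detRowAlternating (n := V) (R := ℝ)).toMultilinearMap.map_sum_finset g S).trans ?_
  have hterm : ∀ f ∈ Fintype.piFinset S,
      (detRowAlternating (n := V) (R := ℝ)).toMultilinearMap (fun i => g i (f i)) =
        if IsRootMap G X f then 1 else 0 := by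
    intro f hf
    rw [Fintype.mem_piFinset] at hf
    have hfix : ∀ v ∈ X, f v = v := fun v hv => by simpa [S, hv] using hf v
    have hadj : ∀ v ∉ X, G.Adj v (f v) := fun v hv => by simpa [S, hv] using hf v
    change Matrix.det (1 - stoppedMatrix X f) = _
    split_ifs with h
    · exact det_one_sub_stoppedMatrix_of_forall h.exists_iterate_mem
    · exact det_one_sub_stoppedMatrix_of_not fun h' => h ⟨hfix, hadj, h'⟩
  rw [Finset.sum_congr rfl hterm, Finset.sum_boole, Nat.card_eq_fintype_card,
    Fintype.card_subtype]
  congr 2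
  ext f
  simp only [Finset.mem_filter, Fintype.mem_piFinset, Finset.mem_univ, true_and,
    and_iff_right_iff_imp]
  intro hf v
  by_cases hv : v ∈ X
  · simp [S, hv, hf.fixed v hv]
  · simpa [S, hv] using hf.adj v hv

end MatrixTree

/-! ### The law of the roots and its marginal kernel -/

section Law

theorem sum_toReal_eq_one {α : Type*} [Fintype α] (μ : PMF α) : ∑ X, (μ X).toReal = 1 := by
  rw [← ENNReal.toReal_sum fun X _ => PMF.apply_ne_top _ _, ← tsum_fintype (L := .unconditional _),
    PMF.tsum_coe, ENNReal.toReal_one]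

variable {V : Type*} [Fintype V] [DecidableEq V]

theorem exists_rootsLaw_toReal_eq (G : SimpleGraph V) {q : ℝ} (hq : 0 < q) :
    ∃ a : ℝ, 0 < a ∧ ∀ X : Finset V, (rootsLaw G q hq X).toReal =
      a * (q ^ X.card * Nat.card {φ : RootedSpanningForest G // φ.roots = X}) := by
  classical
  have := Fintype.ofFinite (RootedSpanningForest G)
  let Z : ℝ := ∑ φ : RootedSpanningForest G, q ^ φ.roots.card
  have hZ : 0 < Z := Finset.sum_pos (fun φ _ => pow_pos hq _) Finset.univ_nonempty
  refine ⟨Z⁻¹, inv_pos.mpr hZ, fun X => ?_⟩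
  have hφ : ∀ φ, spanningForestLaw G q hq φ = ENNReal.ofReal (q ^ φ.roots.card * Z⁻¹) := by
    intro φ
    rw [spanningForestLaw, PMF.normalize_apply, tsum_fintype,
      ← ENNReal.ofReal_sum_of_nonneg fun φ _ => (pow_pos hq φ.roots.card).le,
      ENNReal.ofReal_mul (pow_pos hq _).le, ENNReal.ofReal_inv_of_pos hZ]
  rw [rootsLaw, PMF.map_apply, tsum_fintype, ENNReal.toReal_sum]
  · refine (Finset.sum_congr rfl fun φ _ =>
      (?_ : _ = if φ.roots = X then q ^ X.card * Z⁻¹ else 0)).trans ?_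
    · by_cases h : φ.roots = X
      · subst h
        rw [if_pos rfl, if_pos rfl, hφ, ENNReal.toReal_ofReal]
        exact mul_nonneg (pow_pos hq _).le (inv_pos.mpr hZ).le
      · rw [if_neg (Ne.symm h), if_neg h, ENNReal.toReal_zero]
    · rw [← Finset.sum_filter, Finset.sum_const, nsmul_eq_mul, Nat.card_eq_fintype_card,
        Fintype.card_subtype]
      ring
  · intro φ _
    split_ifs
    · exact PMF.apply_ne_top _ _
    · exact ENNReal.zero_ne_top

theorem pow_mul_card_eq (G : SimpleGraph V) [DecidableRel G.Adj] {q : ℝ} (hq : 0 < q)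
    (X : Finset V) :
    q ^ X.card * Nat.card {φ : RootedSpanningForest G // φ.roots = X} =
      q ^ Fintype.card V * complMinor (q⁻¹ • G.lapMatrix ℝ) X := by
  rw [← complMinor_lapMatrix, complMinor_smul, ← mul_assoc, inv_pow, ← div_eq_mul_inv,
    eq_div_of_mul_eq (a := q ^ X.card) (pow_pos hq (Fintype.card V - X.card)).ne']
  rw [← pow_add, Nat.add_sub_cancel' X.card_le_univ]

theorem posSemidef_smul_lapMatrix (G : SimpleGraph V) [DecidableRel G.Adj] {c : ℝ} (hc : 0 ≤ c) :
    (c • G.lapMatrix ℝ).PosSemidef :=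
  (G.posSemidef_lapMatrix ℝ).smul hc

/-- Total mass 1 determines the constant, through `sum_complMinor` at the empty set. -/
theorem rootsLaw_toReal (G : SimpleGraph V) [DecidableRel G.Adj] {q : ℝ} (hq : 0 < q)
    (X : Finset V) :
    (rootsLaw G q hq X).toReal =
      ((1 + q⁻¹ • G.lapMatrix ℝ).det)⁻¹ * complMinor (q⁻¹ • G.lapMatrix ℝ) X := by
  obtain ⟨a, ha, haX⟩ := exists_rootsLaw_toReal_eq G hq
  have hmul : ∀ X, (rootsLaw G q hq X).toReal =
      a * q ^ Fintype.card V * complMinor (q⁻¹ • G.lapMatrix ℝ) X := fun X => by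
    rw [haX, pow_mul_card_eq G hq, mul_assoc]
  have hsum := sum_complMinor (q⁻¹ • G.lapMatrix ℝ) ∅
  have hdet : complMinor (1 + q⁻¹ • G.lapMatrix ℝ) ∅ = (1 + q⁻¹ • G.lapMatrix ℝ).det := by
    rw [← det_ite_one]
    congr 1
  have hone := sum_toReal_eq_one (rootsLaw G q hq)
  rw [Finset.sum_congr rfl fun X _ => hmul X, ← Finset.mul_sum] at hone
  simp only [Finset.empty_subset, Finset.filter_true] at hsum
  rw [hsum, hdet] at hone
  rw [hmul, eq_inv_of_mul_eq_one_left hone]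

theorem isDPP_of_forall_toReal_eq {μ : PMF (Finset V)} {T : Matrix V V ℝ} (hT : T.PosSemidef)
    (hμ : ∀ X, (μ X).toReal = ((1 + T).det)⁻¹ * complMinor T X) : IsDPP μ (1 + T)⁻¹ := by
  have hpos : (1 + T).PosDef := Matrix.PosDef.one.add_posSemidef hT
  have hunit : IsUnit (1 + T).det := hpos.det_pos.ne'.isUnit
  have hinv := hpos.inv
  refine ⟨hinv.posSemidef, ?_, fun A => ?_⟩
  -- With K = (1 + T)⁻¹, the identity T + T² = (1 + T)² - (1 + T) gives 1 - K = K(T + T²)K.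
  · have hTT : (T + Tᴴ * T).PosSemidef := hT.add (Matrix.posSemidef_conjTranspose_mul_self T)
    have h := hTT.conjTranspose_mul_mul_same (1 + T)⁻¹
    have heq : T + Tᴴ * T = (1 + T) * (1 + T) - (1 + T) := by
      rw [hT.isHermitian.eq]
      noncomm_ring
    rw [hinv.isHermitian.eq, heq, Matrix.mul_sub, Matrix.sub_mul, ← Matrix.mul_assoc,
      Matrix.nonsing_inv_mul _ hunit, Matrix.one_mul, Matrix.mul_nonsing_inv _ hunit,
      Matrix.one_mul] at h
    exact h
  · rw [det_submatrix_eq_det_mul_complMinor (Matrix.nonsing_inv_mul _ hunit),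
      Finset.sum_congr rfl fun X _ => hμ X, ← Finset.mul_sum, sum_complMinor,
      Matrix.det_nonsing_inv, Ring.inverse_eq_inv']

end Law

/-! ### The pseudoinverse of the Laplacian -/

section Pseudoinverse

theorem IsMoorePenrose.transpose {m n : Type*} [Fintype m] [Fintype n]
    {A : Matrix m n ℝ} {B : Matrix n m ℝ} (h : IsMoorePenrose A B) : IsMoorePenrose Aᵀ Bᵀ where
  mul_mul_self := by rw [← transpose_mul, ← transpose_mul, ← Matrix.mul_assoc, h.mul_mul_self]
  mul_self_mul := by rw [← transpose_mul, ← transpose_mul, ← Matrix.mul_assoc, h.mul_self_mul]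
  symm_left := by rw [← transpose_mul, h.symm_right, h.symm_right]
  symm_right := by rw [← transpose_mul, h.symm_left, h.symm_left]

theorem pinv_transpose {m n : Type*} [Fintype m] [Fintype n] (A : Matrix m n ℝ) :
    (pinv A)ᵀ = pinv Aᵀ :=
  (isMoorePenrose_pinv A).transpose.unique (isMoorePenrose_pinv Aᵀ)

/-- For symmetric A, A† is symmetric and A† = (A†)ᵀ A A† is a congruence transform of A. -/
theorem posSemidef_pinv {n : Type*} [Fintype n] {A : Matrix n n ℝ} (hA : A.PosSemidef) :
    (pinv A).PosSemidef := by
  have hAt : Aᵀ = A := by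
    rw [← conjTranspose_eq_transpose_of_trivial, hA.isHermitian.eq]
  have h := hA.conjTranspose_mul_mul_same (pinv A)
  rwa [conjTranspose_eq_transpose_of_trivial, pinv_transpose, hAt,
    (isMoorePenrose_pinv A).mul_self_mul] at h

variable {V : Type*} [Fintype V] [DecidableEq V]

theorem lapMatrix_mul_onesCol (G : SimpleGraph V) [DecidableRel G.Adj] :
    G.lapMatrix ℝ * onesCol V = 0 := by
  ext i j
  exact congrFun (G.lapMatrix_mulVec_const_eq_zero (R := ℝ)) i

theorem pinv_lapMatrix_transpose (G : SimpleGraph V) [DecidableRel G.Adj] :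
    (pinv (G.lapMatrix ℝ))ᵀ = pinv (G.lapMatrix ℝ) := by
  rw [pinv_transpose, (G.isSymm_lapMatrix (R := ℝ)).eq]

/-- By symmetry 𝓛 and 𝓛† commute, so 𝓛† = 𝓛†𝓛𝓛† = 𝓛†𝓛†𝓛, which kills 𝟙. -/
theorem pinv_lapMatrix_mul_onesCol (G : SimpleGraph V) [DecidableRel G.Adj] :
    pinv (G.lapMatrix ℝ) * onesCol V = 0 := by
  have h := isMoorePenrose_pinv (G.lapMatrix ℝ)
  have hs := h.symm_left
  rw [transpose_mul, pinv_lapMatrix_transpose, (G.isSymm_lapMatrix (R := ℝ)).eq] at hs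
  rw [← h.mul_self_mul, Matrix.mul_assoc (pinv _), ← hs, Matrix.mul_assoc, Matrix.mul_assoc,
    lapMatrix_mul_onesCol, Matrix.mul_zero, Matrix.mul_zero]

/-- The Laplacian of a connected graph is inverted by its pseudoinverse, up to the projection on
the constant vectors. -/
theorem pinv_lapMatrix_mul_lapMatrix (G : SimpleGraph V) [DecidableRel G.Adj]
    (hG : G.Connected) :
    pinv (G.lapMatrix ℝ) * G.lapMatrix ℝ +
      (Fintype.card V : ℝ)⁻¹ • (onesCol V * (onesCol V)ᵀ) = 1 := by
  have h := isMoorePenrose_pinv (G.lapMatrix ℝ)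
  have hcard : (Fintype.card V : ℝ) ≠ 0 := by
    have := hG.nonempty
    exact_mod_cast Fintype.card_ne_zero
  -- The columns of Q lie in ker 𝓛, so they are constant by connectedness; symmetry makes all
  -- entries equal, and Q𝟙 = 𝟙 makes them 1/n.
  obtain ⟨Q, hQ⟩ : ∃ Q, Q = 1 - pinv (G.lapMatrix ℝ) * G.lapMatrix ℝ := ⟨_, rfl⟩
  have hLQ : G.lapMatrix ℝ * Q = 0 := by
    rw [hQ, Matrix.mul_sub, Matrix.mul_one, ← Matrix.mul_assoc, h.mul_mul_self, sub_self]
  have hsymm : Qᵀ = Q := by rw [hQ, transpose_sub, transpose_one, h.symm_right]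
  have hones : Q * onesCol V = onesCol V := by
    rw [hQ, Matrix.sub_mul, Matrix.one_mul, Matrix.mul_assoc, lapMatrix_mul_onesCol,
      Matrix.mul_zero, sub_zero]
  have hcol : ∀ i i' j, Q i j = Q i' j := by
    intro i i' j
    refine (G.lapMatrix_mulVec_eq_zero_iff_forall_reachable (x := fun k => Q k j)).mp ?_ i i'
      (hG.preconnected i i')
    funext k
    exact congrFun (congrFun hLQ k) j
  have hrow : ∀ i j j', Q i j = Q i j' := fun i j j' => by
    rw [← hsymm]
    exact hcol j j' i
  have hval : ∀ i j, Q i j = (Fintype.card V : ℝ)⁻¹ := by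
    intro i j
    have hi : ∑ k, Q i k = 1 := by
      simpa [Matrix.mul_apply, onesCol] using congrFun (congrFun hones i) 0
    rw [Finset.sum_congr rfl fun k _ => hrow i k j, Finset.sum_const, Finset.card_univ,
      nsmul_eq_mul] at hi
    exact eq_inv_of_mul_eq_one_right hi
  have hJ : (Fintype.card V : ℝ)⁻¹ • (onesCol V * (onesCol V)ᵀ) = Q := by
    ext i j
    simp [hval, Matrix.mul_apply, onesCol]
  rw [hJ, hQ, add_sub_cancel]

theorem isNonnegativePair_pinv_lapMatrix (G : SimpleGraph V) [DecidableRel G.Adj] [Nonempty V]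
    {q : ℝ} (hq : 0 ≤ q) :
    IsNonnegativePair (q • pinv (G.lapMatrix ℝ)) (onesCol V) where
  symm := by rw [transpose_smul, pinv_lapMatrix_transpose]
  cond_nonneg x _ := by
    simpa using ((posSemidef_pinv (G.posSemidef_lapMatrix ℝ)).smul hq).dotProduct_mulVec_nonneg x
  full_rank := by
    rw [← rank_transpose]
    refine LinearIndependent.rank_matrix ?_
    refine LinearIndependent.of_subsingleton 0 fun h => ?_
    obtain ⟨v⟩ := (inferInstance : Nonempty V)
    exact one_ne_zero (congrFun h v)

end Pseudoinverse

/-! ### The extended mass as a minor of the Laplacian -/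

section ExtendedMass

/-- A value independent of L, used to fix the sign of the proportionality constant. -/
theorem extMass_singleton {V : Type*} [DecidableEq V] {L : Matrix V V ℝ} (v : V) :
    extMass L (onesCol V) {v} = 1 := by
  let e : Fin 2 ≃ ({v} : Finset V) ⊕ Fin 1 :=
    (finSumFinEquiv (m := 1) (n := 1)).symm.trans
      ((Equiv.ofUnique (Fin 1) ({v} : Finset V)).sumCongr (Equiv.refl _))
  rw [extMass, ← det_submatrix_equiv_self e, det_fin_two]
  have h0 : e 0 = Sum.inl ⟨v, Finset.mem_singleton_self v⟩ := rfl
  have h1 : e 1 = Sum.inr 0 := rfl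
  simp [h0, h1, onesCol]

variable {V : Type*} [Fintype V] [DecidableEq V]

/-- Jacobi's identity for the bordered matrix: the border index is grouped with X, so the
complementary minor of the inverse involves only T. -/
theorem extMass_eq_det_mul_complMinor {L T : Matrix V V ℝ} {B : Matrix V (Fin 1) ℝ}
    {C : Matrix (Fin 1) V ℝ} {W : Matrix V (Fin 1) ℝ}
    (h : fromBlocks L W Wᵀ 0 * fromBlocks T B C 0 = 1) (X : Finset V) :
    extMass L W X = -(fromBlocks L W Wᵀ 0).det * complMinor T X := by
  let e : (X ⊕ Fin 1) ⊕ {x // x ∉ X} ≃ V ⊕ Fin 1 :=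
    (Equiv.sumAssoc _ _ _).trans (((Equiv.refl _).sumCongr (Equiv.sumComm _ _)).trans
      ((Equiv.sumAssoc _ _ _).symm.trans ((Equiv.sumCompl (· ∈ X)).sumCongr (Equiv.refl _))))
  have hdet := det_submatrix_inl e h
  have hl : (fromBlocks L W Wᵀ 0).submatrix (e ∘ Sum.inl) (e ∘ Sum.inl) =
      fromBlocks (L.submatrix (Subtype.val : X → V) (Subtype.val : X → V))
        (W.submatrix (Subtype.val : X → V) id) (W.submatrix (Subtype.val : X → V) id)ᵀ
        (0 : Matrix (Fin 1) (Fin 1) ℝ) := by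
    ext (i | i) (j | j) <;> rfl
  have hr : (fromBlocks T B C 0).submatrix (e ∘ Sum.inr) (e ∘ Sum.inr) =
      T.submatrix (Subtype.val : {x // x ∉ X} → V) Subtype.val := by
    ext i j
    rfl
  rw [hl, hr] at hdet
  rw [extMass, hdet, complMinor, Fintype.card_fin, pow_one]
  ring

theorem exists_extMass_eq (G : SimpleGraph V) [DecidableRel G.Adj] (hG : G.Connected)
    {q : ℝ} (hq : 0 < q) :
    ∃ c : ℝ, 0 < c ∧ ∀ X, extMass (q • pinv (G.lapMatrix ℝ)) (onesCol V) X =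
      c * complMinor (q⁻¹ • G.lapMatrix ℝ) X := by
  have hcard : (Fintype.card V : ℝ) ≠ 0 := by
    have := hG.nonempty
    exact_mod_cast Fintype.card_ne_zero
  have hinv : fromBlocks (q • pinv (G.lapMatrix ℝ)) (onesCol V) (onesCol V)ᵀ 0 *
      fromBlocks (q⁻¹ • G.lapMatrix ℝ) ((Fintype.card V : ℝ)⁻¹ • onesCol V)
        ((Fintype.card V : ℝ)⁻¹ • (onesCol V)ᵀ) 0 = 1 := by
    have h21 : (onesCol V)ᵀ * G.lapMatrix ℝ = 0 := by
      rw [← transpose_inj, transpose_mul, transpose_transpose, (G.isSymm_lapMatrix (R := ℝ)).eq,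
        lapMatrix_mul_onesCol, transpose_zero]
    have h22 : (onesCol V)ᵀ * onesCol V = (Fintype.card V : ℝ) • 1 := by
      ext i j
      simp [Matrix.mul_apply, onesCol, Subsingleton.elim i j]
    rw [fromBlocks_multiply, ← fromBlocks_one, fromBlocks_inj]
    refine ⟨?_, ?_, ?_, ?_⟩
    · rw [Matrix.smul_mul, Matrix.mul_smul, smul_smul, mul_inv_cancel₀ hq.ne', one_smul,
        Matrix.mul_smul, pinv_lapMatrix_mul_lapMatrix G hG]
    · rw [Matrix.smul_mul, Matrix.mul_smul, pinv_lapMatrix_mul_onesCol]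
      simp
    · rw [Matrix.mul_smul, h21]
      simp
    · rw [Matrix.mul_smul, h22, smul_smul, inv_mul_cancel₀ hcard]
      simp
  refine ⟨_, ?_, extMass_eq_det_mul_complMinor hinv⟩
  -- At a singleton the mass is 1 and the minor, a scaled forest count, is nonnegative; hence the
  -- constant is positive.
  obtain ⟨v⟩ := hG.nonempty
  have hv := extMass_eq_det_mul_complMinor hinv {v}
  rw [extMass_singleton] at hv
  have hnonneg : 0 ≤ complMinor (q⁻¹ • G.lapMatrix ℝ) {v} := by
    rw [complMinor_smul, complMinor_lapMatrix]
    positivity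
  exact pos_of_mul_pos_left (hv ▸ one_pos) hnonneg

end ExtendedMass

end RootsForest

theorem mainTheorem9 {V : Type*} [Fintype V] [DecidableEq V] (G : SimpleGraph V)
    [DecidableRel G.Adj] (hG : G.Connected) (q : ℝ) (hq : 0 < q) :
    RootsForest.IsPartialProjectionDPP (RootsForest.rootsLaw G q hq)
      (q • RootsForest.pinv (G.lapMatrix ℝ)) (RootsForest.onesCol V) := by
  have hT := RootsForest.posSemidef_smul_lapMatrix G (inv_pos.mpr hq).le
  have := hG.nonempty
  obtain ⟨c, hc, hmass⟩ := RootsForest.exists_extMass_eq G hG hq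
  refine ⟨⟨_, RootsForest.isDPP_of_forall_toReal_eq hT (RootsForest.rootsLaw_toReal G hq)⟩,
    by simp, RootsForest.isNonnegativePair_pinv_lapMatrix G hq.le,
    ((1 + q⁻¹ • G.lapMatrix ℝ).det)⁻¹ * c⁻¹, ?_, fun X => ?_⟩
  · exact mul_pos (inv_pos.mpr (Matrix.PosDef.one.add_posSemidef hT).det_pos) (inv_pos.mpr hc)
  · rw [RootsForest.rootsLaw_toReal, hmass, mul_assoc, inv_mul_cancel_left₀ hc.ne']
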